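/- Let $\overline{\mathcal P}_N$ denote the group of $N$-qubit Pauli operators modulo the phases $\{\pm I,\pm iI\}$, and for $P,Q\in\overline{\mathcal P}_N$ let $[P,Q]\in\mathbb Z_2$ be $0$ if $P$ and $Q$ commute and $1$ otherwise. A Clifford circuit $\mathcal C=(C_1,\dots,C_s)$ on $n$ qubits is a sequence of operations, each a Clifford unitary gate or the measurement of a Hermitian Pauli operator, where $C_i$ has a level $\mathrm{level}(C_i)\in\{1,2,\dots\}$, the levels are non-decreasing in $i$, and distinct operations at the same level have disjoint supports. The input state is arbitrary. Let $\Delta$ be the depth (the maximum level), let $S_1,\dots,S_m$ be the measured operators and $\ell_1,\dots,\ell_m$ their levels. The outcome code $\mathcal O(\mathcal C)\subseteq\mathbb Z_2^m$ is the set of all outcome bit-strings that occur with non-zero probability for some input state, where outcome $o_j$ corresponds to the eigenvalue $(-1)^{o_j}$ of $S_j$. Assume that $\mathcal O(\mathcal C)$ is a linear subspace of $\mathbb Z_2^m$, and let $\mathcal O(\mathcal C)^\perp$ be its dual code for the binary inner product $(u|v)=\sum_j u_jv_j \bmod 2$. A fault operator is an element $F\in\overline{\mathcal P}_{n(\Delta+1)}$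 on qubits indexed by $(\ell+0.5,q)$ with $0\le\ell\le\Delta$ and $1\le q\le n$; write $F_{\ell+0.5}\in\overline{\mathcal P}_n$ for its component at $\ell+0.5$. Its back-cumulant $\overleftarrow{F}$ is defined by $\overleftarrow{F}_{\Delta+0.5}=F_{\Delta+0.5}$ and, for $\ell=\Delta,\Delta-1,\dots,1$, $$\overleftarrow{F}_{\ell-0.5}=F_{\ell-0.5}\cdot U_\ell^{-1}\,\overleftarrow{F}_{\ell+0.5}\,U_\ell ,$$ where $U_\ell$ is the product of all unitary gates at level $\ell$. For $u\in\mathbb Z_2^m$ put $F(u)=\prod_{j=1}^m\eta_{\ell_j-0.5}(S_j^{u_j})$, where $\eta_{\ell+0.5}(P)$ is the fault operator equal to $P$ at $\ell+0.5$ and trivial elsewhere. **Proposition.** For every Clifford circuit $\mathcal C$ whose outcome code is linear, and all $u,v\in\mathcal O(\mathcal C)^\perp$, the check operators $\overleftarrow{F(u)}$ and $\overleftarrow{F(v)}$ commute: $$[\overleftarrow{F(u)},\overleftarrow{F(v)}]=0 .$$ -/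

import Mathlib

open scoped Matrix ComplexOrder

noncomputable section

/-! ### Pauli operators up to phase -/

/-- The four single-qubit Pauli operators, up to phase. -/
inductive Pauli
  | I
  | X
  | Y
  | Z

namespace Pauli

/-- The matrix of a single-qubit Pauli operator in the computational basis. -/
def toMatrix : Pauli → Matrix (Fin 2) (Fin 2) ℂ
  | I => !![1, 0; 0, 1]
  | X => !![0, 1; 1, 0]
  | Y => !![0, -Complex.I; Complex.I, 0]
  | Z => !![1, 0; 0, -1]

/-- Multiplication of single-qubit Pauli operators, up to phase. -/
protected def mul : Pauli → Pauli → Pauli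
  | I, Q => Q
  | P, I => P
  | X, X => I
  | X, Y => Z
  | X, Z => Y
  | Y, X => Z
  | Y, Y => I
  | Y, Z => X
  | Z, X => Y
  | Z, Y => X
  | Z, Z => I

instance : CommGroup Pauli where
  mul := Pauli.mul
  one := I
  inv P := P
  mul_assoc := by rintro ⟨⟩ ⟨⟩ ⟨⟩ <;> rfl
  one_mul := by rintro ⟨⟩ <;> rfl
  mul_one := by rintro ⟨⟩ <;> rfl
  inv_mul_cancel := by rintro ⟨⟩ <;> rfl
  mul_comm := by rintro ⟨⟩ ⟨⟩ <;> rfl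

end Pauli

/-- Pauli operators up to phase on qubits labelled by `ι`. The group structure is the pointwise one,
i.e. multiplication of Pauli operators up to phase. -/
abbrev PauliString (ι : Type*) := ι → Pauli

/-- Linear operators on the qubits labelled by `ι`, as matrices in the computational basis. -/
abbrev QubitOp (ι : Type*) := Matrix (ι → Fin 2) (ι → Fin 2) ℂ

section Operators

variable {ι : Type*} [Fintype ι] [DecidableEq ι]

/-- The tensor product of the matrices of the letters of `P`: the representative with letters
`I, X, Y, Z` and trivial overall phase. -/
def PauliString.toOp (P : PauliString ι) : QubitOp ι :=
  Matrix.of fun x y => ∏ q, (P q).toMatrix (x q) (y q)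

open Classical in
/-- The commutator `[P, Q] ∈ ℤ/2`: it is `0` if `P` and `Q` commute and `1` otherwise. -/
def pauliCommutator (P Q : PauliString ι) : ZMod 2 :=
  if Commute P.toOp Q.toOp then 0 else 1

/-- A unitary is Clifford if conjugation by it maps Pauli operators to Pauli operators (with a
phase among `1, -1, i, -i`). -/
def IsClifford (U : Matrix.unitaryGroup (ι → Fin 2) ℂ) : Prop :=
  ∀ P : PauliString ι, ∃ (Q : PauliString ι) (c : ℂ), c ^ 4 = 1 ∧
    (U : QubitOp ι) * P.toOp * ((U⁻¹ : Matrix.unitaryGroup (ι → Fin 2) ℂ) : QubitOp ι) = c • Q.toOp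

open Classical in
/-- The conjugate `U P U⁻¹` up to phase: the unique Pauli string proportional to it, which exists
when `U` is Clifford (the value is irrelevant otherwise). -/
def pauliConj (U : Matrix.unitaryGroup (ι → Fin 2) ℂ) (P : PauliString ι) : PauliString ι :=
  if h : ∃ Q : PauliString ι, ∃ c : ℂ, c ^ 4 = 1 ∧
      (U : QubitOp ι) * P.toOp * ((U⁻¹ : Matrix.unitaryGroup (ι → Fin 2) ℂ) : QubitOp ι)
        = c • Q.toOp
  then h.choose else 1

/-- `A` acts trivially on the qubit `q`: it is the tensor product of the identity on `q` with an
operator `B` on the other qubits. -/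
def ActsTriviallyAt (A : QubitOp ι) (q : ι) : Prop :=
  ∃ B : QubitOp {q' : ι // q' ≠ q}, ∀ x y : ι → Fin 2,
    A x y = if x q = y q then B (fun q' => x q') (fun q' => y q') else 0

/-- The support of an operator: the set of qubits on which it acts non-trivially. -/
def opSupport (A : QubitOp ι) : Set ι := {q | ¬ ActsTriviallyAt A q}

/-- A density matrix. -/
def IsDensityMatrix (ρ : QubitOp ι) : Prop := ρ.PosSemidef ∧ ρ.trace = 1

end Operators

/-! ### Clifford circuits -/

/-- An operation on `n` qubits: a Clifford unitary gate, or the measurement of the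
Hermitian Pauli operator `sign • P`. -/
inductive CliffordOp (n : ℕ)
  | gate (U : Matrix.unitaryGroup (Fin n → Fin 2) ℂ) (hU : IsClifford U)
  | measure (sign : ℤˣ) (P : PauliString (Fin n))

namespace CliffordOp

variable {n : ℕ}

/-- Whether the operation is a measurement. -/
def isMeasure : CliffordOp n → Bool
  | gate _ _ => false
  | measure _ _ => true

/-- The support of an operation: the qubits on which it acts non-trivially. -/
def support : CliffordOp n → Set (Fin n)
  | gate U _ => opSupport (U : QubitOp (Fin n))
  | measure _ P => {q | P q ≠ 1}

/-- The unitary applied by an operation (trivial for a measurement). -/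
def unitaryPart : CliffordOp n → Matrix.unitaryGroup (Fin n → Fin 2) ℂ
  | gate U _ => U
  | measure _ _ => 1

/-- The measured Pauli operator, up to phase (only used for measurements). -/
def measured : CliffordOp n → PauliString (Fin n)
  | gate _ _ => 1
  | measure _ P => P

/-- The operator applied to the state: the unitary for a gate (the bit `b` is then ignored), and
the projector `(1 + (-1)^b S) / 2` for a measurement of `S` with outcome `b`. -/
def kraus : CliffordOp n → ZMod 2 → QubitOp (Fin n)
  | gate U _, _ => U
  | measure sign P, b =>
      (1 / 2 : ℂ) • (1 + ((-1 : ℂ) ^ b.val * ((sign : ℤ) : ℂ)) • P.toOp)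

end CliffordOp

/-- A Clifford circuit on `n` qubits: a sequence of Clifford operations in chronological order, at
levels `1, 2, …`, such that distinct operations at the same level have disjoint supports. -/
structure CliffordCircuit (n : ℕ) where
  /-- the number of operations -/
  size : ℕ
  /-- the operations -/
  op : Fin size → CliffordOp n
  /-- the level of each operation -/
  level : Fin size → ℕ
  one_le_level : ∀ i, 1 ≤ level i
  level_mono : ∀ i j, i ≤ j → level i ≤ level j
  disjoint_support : ∀ i j, i ≠ j → level i = level j →
    Disjoint (op i).support (op j).support

namespace CliffordCircuit

variable {n : ℕ} (C : CliffordCircuit n)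

/-- The depth: the maximum level of the operations (`0` for the empty circuit). -/
def depth : ℕ := Finset.univ.sup C.level

theorem level_sub_one_lt (i : Fin C.size) : C.level i - 1 < C.depth + 1 :=
  Nat.lt_succ_of_le ((Nat.sub_le _ _).trans (Finset.le_sup (f := C.level) (Finset.mem_univ i)))

/-- The measurements of the circuit, given by their positions in the sequence of operations. -/
abbrev Meas : Type := {i : Fin C.size // (C.op i).isMeasure = true}

/-- The operator applied by the `i`-th operation when the outcome bit-string is `o`. -/
def krausAt (o : C.Meas → ZMod 2) (i : Fin C.size) : QubitOp (Fin n) :=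
  (C.op i).kraus (if h : (C.op i).isMeasure = true then o ⟨i, h⟩ else 0)

/-- The unnormalized output state on input `ρ` with outcome bit-string `o`: the operations are
applied one after the other in chronological order. -/
def outputState (ρ : QubitOp (Fin n)) (o : C.Meas → ZMod 2) : QubitOp (Fin n) :=
  (List.finRange C.size).foldl (fun σ i => C.krausAt o i * σ * (C.krausAt o i)ᴴ) ρ

/-- The probability of the outcome bit-string `o` on input state `ρ`. -/
def outcomeProb (ρ : QubitOp (Fin n)) (o : C.Meas → ZMod 2) : ℝ :=
  (C.outputState ρ o).trace.re

/-- The outcome code: the set of all outcome bit-strings that occur with positive probability for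
some input state. -/
def outcomeCode : Set (C.Meas → ZMod 2) :=
  {o | ∃ ρ : QubitOp (Fin n), IsDensityMatrix ρ ∧ 0 < C.outcomeProb ρ o}

/-- The product, in chronological order, of all unitary operations with level `l`. -/
def levelUnitary (l : ℕ) : Matrix.unitaryGroup (Fin n → Fin 2) ℂ :=
  (((List.finRange C.size).filter fun i => C.level i = l).map
    fun i => (C.op i).unitaryPart).reverse.prod

/-- Fault operators: Pauli operators up to phase on the qubits `(l + 0.5, q)`, where
`l ∈ {0, …, depth}`. The position `l + 0.5` is encoded by `l : Fin (depth + 1)`. -/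
abbrev FaultOp : Type := PauliString (Fin (C.depth + 1) × Fin n)

variable {C}

/-- The component of a fault operator right after level `l`. -/
def FaultOp.slice (F : C.FaultOp) (l : Fin (C.depth + 1)) : PauliString (Fin n) :=
  fun q => F (l, q)

variable (C)

/-- The fault operator with the Pauli operator `P` right after level `l` and the identity
elsewhere. -/
def eta (l : Fin (C.depth + 1)) (P : PauliString (Fin n)) : C.FaultOp :=
  fun p => if p.1 = l then P p.2 else 1

/-- The back-cumulant `B` of `F`. At the end of the circuit `B` agrees with `F`; going backward,
the component of `B` right before level `l + 1` is that of `F` multiplied by the component of `B`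
right after level `l + 1` conjugated by the inverse of the product of the unitaries of that
level. -/
def backCumulant (F : C.FaultOp) : C.FaultOp :=
  fun p => Fin.reverseInduction (motive := fun _ => PauliString (Fin n))
    (FaultOp.slice F (Fin.last C.depth))
    (fun l B => FaultOp.slice F l.castSucc * pauliConj (C.levelUnitary (l + 1))⁻¹ B) p.1 p.2

/-- The fault operator `F(u)`: the product over the measurements `j` of `S_j ^ u_j` placed right
before the level of the measurement of `S_j`. -/
def measurementFault (u : C.Meas → ZMod 2) : C.FaultOp :=
  ∏ j : C.Meas, C.eta ⟨C.level j - 1, C.level_sub_one_lt j⟩ ((C.op j).measured ^ (u j).val)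

/-- The check operator of `u`: the back-cumulant of `F(u)`. -/
def checkOperator (u : C.Meas → ZMod 2) : C.FaultOp :=
  C.backCumulant (C.measurementFault u)

end CliffordCircuit

/-- The dual of a binary linear code: the vectors orthogonal to all its elements for the binary
inner product. -/
def dualCode {κ : Type*} [Fintype κ] (O : Submodule (ZMod 2) (κ → ZMod 2)) : Set (κ → ZMod 2) :=
  {u | ∀ o ∈ O, u ⬝ᵥ o = 0}

end

/-! Write `K o` for the product of the Kraus operators with outcomes `o`. Testing on the maximally
mixed state shows that `o` lies in the outcome code exactly when `K o ≠ 0` (`mem_outcomeCode_iff`).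

A Pauli operator `Q` inserted before the tail `L` of the circuit can be pushed to the end. Gates
conjugate it, and each measurement it anticommutes with has its outcome flipped. The resulting flip
`f` satisfies `u ⬝ᵥ f = comm Q B_u`, where `B_u` is the product of the measured operators selected
by `u`, propagated back to the start of `L` (`exists_flip`). Take for `Q` the operator `S` measured
just before `L`: the projector absorbs `S` up to a sign, so `K f` is nonzero because `K 0` is. Hence
`f` is a codeword, and `comm S B_u = 0` for every `u` in the dual code (`comm_measured_backProp`).

Now move backward one operation at a time. Gates preserve `comm B_u B_v`, while a measurement of `S`
replaces `B_u`, `B_v` by `S ^ u_i * B_u`, `S ^ v_i * B_v`, and the additional terms vanish by the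
above (`comm_backProp`). Since operations on one level have disjoint supports, the slices of the
check operators are such `B_u` (`slice_checkOperator`). The commutator of two check operators is the
sum over the slices, and every summand is zero. -/

noncomputable section

/-! ### The symplectic form on Pauli strings -/

/-- The sign character of `ℤ/2`. -/
def zmodTwoSign (a : ZMod 2) : ℂ := (-1) ^ a.val

theorem ZMod.eq_zero_or_eq_one_of_two (a : ZMod 2) : a = 0 ∨ a = 1 := by
  fin_cases a
  · exact Or.inl rfl
  · exact Or.inr rfl

@[simp] theorem zmodTwoSign_zero : zmodTwoSign 0 = 1 := by simp [zmodTwoSign]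

@[simp] theorem zmodTwoSign_one : zmodTwoSign 1 = -1 := by
  simp [zmodTwoSign, ZMod.val_one]

theorem zmodTwoSign_add (a b : ZMod 2) :
    zmodTwoSign (a + b) = zmodTwoSign a * zmodTwoSign b := by
  rcases ZMod.eq_zero_or_eq_one_of_two a with rfl | rfl <;>
    rcases ZMod.eq_zero_or_eq_one_of_two b with rfl | rfl <;> simp [CharTwo.add_self_eq_zero]

theorem zmodTwoSign_sum {ι : Type*} (s : Finset ι) (f : ι → ZMod 2) :
    zmodTwoSign (∑ i ∈ s, f i) = ∏ i ∈ s, zmodTwoSign (f i) := by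
  classical
  induction s using Finset.induction_on with
  | empty => simp
  | insert a s ha ih => rw [Finset.sum_insert ha, Finset.prod_insert ha, zmodTwoSign_add, ih]

theorem zmodTwoSign_injective : Function.Injective zmodTwoSign := by
  intro a b h
  rcases ZMod.eq_zero_or_eq_one_of_two a with rfl | rfl <;>
    rcases ZMod.eq_zero_or_eq_one_of_two b with rfl | rfl <;>
    first
    | rfl
    | (norm_num at h)

namespace Pauli

instance : Finite Pauli :=
  Finite.of_surjective (![I, X, Y, Z] : Fin 4 → Pauli) (by
    rintro ⟨⟩
    exacts [⟨0, rfl⟩, ⟨1, rfl⟩, ⟨2, rfl⟩, ⟨3, rfl⟩])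

/-- The commutator of single-qubit Pauli operators. -/
def comm : Pauli → Pauli → ZMod 2
  | I, _ => 0
  | _, I => 0
  | X, X => 0
  | Y, Y => 0
  | Z, Z => 0
  | _, _ => 1

theorem comm_mul_left (p q r : Pauli) : comm (p * q) r = comm p r + comm q r := by
  cases p <;> cases q <;> cases r <;> rfl

theorem comm_symm (p q : Pauli) : comm p q = comm q p := by
  cases p <;> cases q <;> rfl

theorem eq_of_comm_eq {p q : Pauli} (h : ∀ r, comm p r = comm q r) : p = q := by
  have hX := h X
  have hZ := h Z
  cases p <;> cases q <;> first | rfl | (simp [comm] at hX hZ)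

theorem toMatrix_one : (1 : Pauli).toMatrix = 1 := by
  rw [Matrix.one_fin_two]; rfl

theorem toMatrix_mul_comm (p q : Pauli) :
    p.toMatrix * q.toMatrix = zmodTwoSign (comm p q) • (q.toMatrix * p.toMatrix) := by
  cases p <;> cases q <;> simp [toMatrix, comm]

theorem toMatrix_mul_self (p : Pauli) : p.toMatrix * p.toMatrix = 1 := by
  rw [Matrix.one_fin_two]
  cases p <;> simp [toMatrix]

theorem exists_toMatrix_mul (p q : Pauli) :
    ∃ c : ℂ, c ^ 4 = 1 ∧ p.toMatrix * q.toMatrix = c • (p * q).toMatrix := by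
  have h1 : (1 : ℂ) ^ 4 = 1 := one_pow 4
  have h2 : (Complex.I) ^ 4 = 1 := Complex.I_pow_four
  have h3 : (-Complex.I) ^ 4 = 1 := by rw [Even.neg_pow (by decide)]; exact h2
  cases p <;> cases q <;>
    first
    | (refine ⟨1, h1, ?_⟩
       change _ = (1 : ℂ) • (Pauli.mul _ _).toMatrix
       simp [toMatrix, Pauli.mul]
       done)
    | (refine ⟨Complex.I, h2, ?_⟩
       change _ = Complex.I • (Pauli.mul _ _).toMatrix
       simp [toMatrix, Pauli.mul]
       done)
    | (refine ⟨-Complex.I, h3, ?_⟩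
       change _ = (-Complex.I) • (Pauli.mul _ _).toMatrix
       simp [toMatrix, Pauli.mul])

end Pauli

namespace PauliString

section

variable {ι : Type*} [Fintype ι]

/-- The symplectic form on Pauli strings. -/
def comm (P Q : PauliString ι) : ZMod 2 := ∑ q, Pauli.comm (P q) (Q q)

theorem comm_mul_left (P Q R : PauliString ι) : comm (P * Q) R = comm P R + comm Q R := by
  simp [comm, Pauli.comm_mul_left, Finset.sum_add_distrib]

theorem comm_symm (P Q : PauliString ι) : comm P Q = comm Q P :=
  Finset.sum_congr rfl fun _ _ => Pauli.comm_symm _ _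

theorem comm_mul_right (P Q R : PauliString ι) : comm P (Q * R) = comm P Q + comm P R := by
  rw [comm_symm, comm_mul_left, comm_symm Q, comm_symm R]

theorem comm_one_left (P : PauliString ι) : comm 1 P = 0 := by
  have h := comm_mul_left 1 1 P
  rw [mul_one] at h
  exact left_eq_add.mp h

theorem comm_one_right (P : PauliString ι) : comm P 1 = 0 := by
  rw [comm_symm, comm_one_left]

theorem comm_self (P : PauliString ι) : comm P P = 0 :=
  Finset.sum_eq_zero fun q _ => by cases P q <;> rfl

theorem comm_pow_right (P Q : PauliString ι) (a : ZMod 2) :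
    comm P (Q ^ a.val) = a * comm P Q := by
  rcases ZMod.eq_zero_or_eq_one_of_two a with rfl | rfl
  · simp [comm_one_right]
  · simp [ZMod.val_one]

theorem comm_pow_left (P Q : PauliString ι) (a : ZMod 2) :
    comm (P ^ a.val) Q = a * comm P Q := by
  rw [comm_symm, comm_pow_right, comm_symm]

/-! ### Pauli strings as operators -/

theorem prod_one_apply (x y : ι → Fin 2) :
    ∏ q, (1 : Matrix (Fin 2) (Fin 2) ℂ) (x q) (y q) = (1 : QubitOp ι) x y := by
  classical
  simp only [Matrix.one_apply]
  rw [Finset.prod_ite_zero]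
  simp [funext_iff]

theorem toOp_one : (1 : PauliString ι).toOp = 1 := by
  ext x y
  rw [← prod_one_apply]
  simp [toOp, Pauli.toMatrix_one]

end

variable {ι : Type*} [Fintype ι] [DecidableEq ι]

/-- Nondegeneracy of the symplectic form: testing against strings supported on a single qubit
recovers each letter. -/
theorem eq_of_comm_eq {P Q : PauliString ι} (h : ∀ R, comm P R = comm Q R) : P = Q := by
  have key (P : PauliString ι) (q : ι) (r : Pauli) :
      comm P (Pi.mulSingle q r) = Pauli.comm (P q) r := by
    rw [comm, Finset.sum_eq_single q]
    · simp
    · intro q' _ hq'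
      rw [Pi.mulSingle_eq_of_ne hq', Pauli.comm_symm]
      rfl
    · simp
  funext q
  refine Pauli.eq_of_comm_eq fun r => ?_
  rw [← key, ← key, h]

theorem toOp_mul_toOp_apply (P Q : PauliString ι) (x y : ι → Fin 2) :
    (P.toOp * Q.toOp) x y = ∏ q, ((P q).toMatrix * (Q q).toMatrix) (x q) (y q) := by
  simp only [Matrix.mul_apply, toOp, Matrix.of_apply, ← Finset.prod_mul_distrib]
  rw [Finset.prod_univ_sum, Fintype.piFinset_univ]

theorem toOp_mul_self (P : PauliString ι) : P.toOp * P.toOp = 1 := by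
  ext x y
  rw [toOp_mul_toOp_apply, ← prod_one_apply]
  simp [Pauli.toMatrix_mul_self]

theorem toOp_mul_comm (P Q : PauliString ι) :
    P.toOp * Q.toOp = zmodTwoSign (comm P Q) • (Q.toOp * P.toOp) := by
  ext x y
  rw [Matrix.smul_apply, toOp_mul_toOp_apply, toOp_mul_toOp_apply, comm, zmodTwoSign_sum,
    smul_eq_mul, ← Finset.prod_mul_distrib]
  refine Finset.prod_congr rfl fun q _ => ?_
  rw [Pauli.toMatrix_mul_comm, Matrix.smul_apply, smul_eq_mul]

theorem exists_toOp_mul (P Q : PauliString ι) :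
    ∃ c : ℂ, c ^ 4 = 1 ∧ P.toOp * Q.toOp = c • (P * Q).toOp := by
  choose c hc h using fun q => Pauli.exists_toMatrix_mul (P q) (Q q)
  refine ⟨∏ q, c q, by rw [← Finset.prod_pow]; exact Finset.prod_eq_one fun q _ => hc q, ?_⟩
  ext x y
  rw [toOp_mul_toOp_apply, Matrix.smul_apply, smul_eq_mul, toOp, Matrix.of_apply,
    ← Finset.prod_mul_distrib]
  refine Finset.prod_congr rfl fun q _ => ?_
  rw [h, Matrix.smul_apply, smul_eq_mul, Pi.mul_apply]

theorem toOp_mul_ne_zero (P : PauliString ι) {A : QubitOp ι} (hA : A ≠ 0) : P.toOp * A ≠ 0 := by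
  intro h
  apply hA
  rw [← one_mul A, ← toOp_mul_self P, mul_assoc, h, mul_zero]

theorem toOp_mul_toOp_ne_zero (P Q : PauliString ι) : P.toOp * Q.toOp ≠ 0 := by
  refine toOp_mul_ne_zero P fun h => ?_
  have h1 := toOp_mul_self Q
  rw [h, zero_mul] at h1
  exact zero_ne_one h1

/-- Products of Pauli operators are nonzero, so the sign in a commutation relation determines the
commutator. -/
theorem comm_eq_of_toOp_mul_comm {P Q : PauliString ι} {a : ZMod 2}
    (h : P.toOp * Q.toOp = zmodTwoSign a • (Q.toOp * P.toOp)) : comm P Q = a := by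
  rw [toOp_mul_comm] at h
  exact zmodTwoSign_injective (smul_left_injective ℂ (toOp_mul_toOp_ne_zero Q P) h)

theorem pauliCommutator_eq_comm (P Q : PauliString ι) : pauliCommutator P Q = comm P Q := by
  unfold pauliCommutator
  split_ifs with h
  · exact (comm_eq_of_toOp_mul_comm (by simpa using h.eq)).symm
  · rcases ZMod.eq_zero_or_eq_one_of_two (comm P Q) with h0 | h1
    · exact absurd (show P.toOp * Q.toOp = Q.toOp * P.toOp by
        simpa [h0] using toOp_mul_comm P Q) h
    · exact h1.symm

theorem eq_of_toOp_eq_smul {P Q : PauliString ι} {c : ℂ} (h : P.toOp = c • Q.toOp) : P = Q := by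
  refine eq_of_comm_eq fun R => comm_eq_of_toOp_mul_comm ?_
  rw [h, smul_mul_assoc, toOp_mul_comm Q R, mul_smul_comm, smul_comm]

end PauliString

/-! ### Conjugation of Pauli strings by Clifford unitaries -/

section Conjugation

variable {ι : Type*} [Fintype ι] [DecidableEq ι]

open PauliString

theorem unitaryGroup_mul_inv (U : Matrix.unitaryGroup (ι → Fin 2) ℂ) :
    (U : QubitOp ι) * ((U⁻¹ : Matrix.unitaryGroup (ι → Fin 2) ℂ) : QubitOp ι) = 1 :=
  congrArg Subtype.val (mul_inv_cancel U)

theorem unitaryGroup_inv_mul (U : Matrix.unitaryGroup (ι → Fin 2) ℂ) :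
    ((U⁻¹ : Matrix.unitaryGroup (ι → Fin 2) ℂ) : QubitOp ι) * (U : QubitOp ι) = 1 :=
  congrArg Subtype.val (inv_mul_cancel U)

/-- The value of `pauliConj` is a choice; proportional Pauli operators have equal strings, so any
valid candidate is the chosen one. The hypothesis is in intertwining form to avoid handling
inverses. -/
theorem pauliConj_eq_of_mul_eq {U : Matrix.unitaryGroup (ι → Fin 2) ℂ} {P Q : PauliString ι}
    {c : ℂ} (hc : c ^ 4 = 1) (h : (U : QubitOp ι) * P.toOp = c • (Q.toOp * (U : QubitOp ι))) :
    pauliConj U P = Q := by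
  have h' : (U : QubitOp ι) * P.toOp * ((U⁻¹ : Matrix.unitaryGroup (ι → Fin 2) ℂ) : QubitOp ι)
      = c • Q.toOp := by
    rw [h, smul_mul_assoc, mul_assoc, unitaryGroup_mul_inv, mul_one]
  have hex : ∃ Q : PauliString ι, ∃ c : ℂ, c ^ 4 = 1 ∧
      (U : QubitOp ι) * P.toOp * ((U⁻¹ : Matrix.unitaryGroup (ι → Fin 2) ℂ) : QubitOp ι)
        = c • Q.toOp := ⟨Q, c, hc, h'⟩
  rw [pauliConj, dif_pos hex]
  obtain ⟨d, hd, hd'⟩ := hex.choose_spec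
  have hd0 : d ≠ 0 := by rintro rfl; simp at hd
  replace hd' := h'.symm.trans hd'
  refine eq_of_toOp_eq_smul (c := d⁻¹ * c) ?_
  rw [mul_smul, hd', smul_smul, inv_mul_cancel₀ hd0, one_smul]

theorem IsClifford.exists_mul_toOp {U : Matrix.unitaryGroup (ι → Fin 2) ℂ} (hU : IsClifford U)
    (P : PauliString ι) : ∃ c : ℂ, c ^ 4 = 1 ∧
      (U : QubitOp ι) * P.toOp = c • ((pauliConj U P).toOp * (U : QubitOp ι)) := by
  obtain ⟨Q, c, hc, h⟩ := hU P
  have h' : (U : QubitOp ι) * P.toOp = c • (Q.toOp * (U : QubitOp ι)) := by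
    rw [← smul_mul_assoc, ← h, mul_assoc, unitaryGroup_inv_mul, mul_one]
  exact ⟨c, hc, by rw [pauliConj_eq_of_mul_eq hc h']; exact h'⟩

theorem isClifford_of_exists {U : Matrix.unitaryGroup (ι → Fin 2) ℂ}
    (h : ∀ P : PauliString ι, ∃ (Q : PauliString ι) (c : ℂ), c ^ 4 = 1 ∧
      (U : QubitOp ι) * P.toOp = c • (Q.toOp * (U : QubitOp ι))) : IsClifford U := by
  intro P
  obtain ⟨Q, c, hc, h⟩ := h P
  refine ⟨Q, c, hc, ?_⟩
  rw [h, smul_mul_assoc, mul_assoc, unitaryGroup_mul_inv, mul_one]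

theorem isClifford_one : IsClifford (1 : Matrix.unitaryGroup (ι → Fin 2) ℂ) :=
  isClifford_of_exists fun P => ⟨P, 1, one_pow 4, by simp⟩

theorem pauliConj_one (P : PauliString ι) : pauliConj 1 P = P :=
  pauliConj_eq_of_mul_eq (one_pow 4) (by simp)

theorem IsClifford.exists_mul_mul_toOp {U V : Matrix.unitaryGroup (ι → Fin 2) ℂ}
    (hU : IsClifford U) (hV : IsClifford V) (P : PauliString ι) : ∃ c : ℂ, c ^ 4 = 1 ∧
      ((U * V : Matrix.unitaryGroup (ι → Fin 2) ℂ) : QubitOp ι) * P.toOp =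
        c • ((pauliConj U (pauliConj V P)).toOp *
          ((U * V : Matrix.unitaryGroup (ι → Fin 2) ℂ) : QubitOp ι)) := by
  obtain ⟨c, hc, h⟩ := hV.exists_mul_toOp P
  obtain ⟨d, hd, h'⟩ := hU.exists_mul_toOp (pauliConj V P)
  refine ⟨c * d, by rw [mul_pow, hc, hd, one_mul], ?_⟩
  rw [Matrix.UnitaryGroup.mul_val, mul_assoc, h, mul_smul_comm, ← mul_assoc, h', smul_mul_assoc,
    smul_smul, mul_assoc]

theorem IsClifford.mul {U V : Matrix.unitaryGroup (ι → Fin 2) ℂ}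
    (hU : IsClifford U) (hV : IsClifford V) : IsClifford (U * V) :=
  isClifford_of_exists fun P => ⟨_, hU.exists_mul_mul_toOp hV P⟩

theorem pauliConj_mul_unitary {U V : Matrix.unitaryGroup (ι → Fin 2) ℂ}
    (hU : IsClifford U) (hV : IsClifford V) (P : PauliString ι) :
    pauliConj (U * V) P = pauliConj U (pauliConj V P) := by
  obtain ⟨c, hc, h⟩ := hU.exists_mul_mul_toOp hV P
  exact pauliConj_eq_of_mul_eq hc h

/-- Conjugating the product in either order produces the same phase `c * d`, which cancels from the
commutation relation. -/
theorem comm_pauliConj {U : Matrix.unitaryGroup (ι → Fin 2) ℂ} (hU : IsClifford U)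
    (P Q : PauliString ι) : comm (pauliConj U P) (pauliConj U Q) = comm P Q := by
  have key (P Q : PauliString ι) {c d : ℂ}
      (h : (U : QubitOp ι) * P.toOp = c • ((pauliConj U P).toOp * (U : QubitOp ι)))
      (h' : (U : QubitOp ι) * Q.toOp = d • ((pauliConj U Q).toOp * (U : QubitOp ι))) :
      (U : QubitOp ι) * (P.toOp * Q.toOp) =
        (c * d) • ((pauliConj U P).toOp * (pauliConj U Q).toOp * (U : QubitOp ι)) := by
    rw [← mul_assoc, h, smul_mul_assoc, mul_assoc, h', mul_smul_comm, smul_smul, mul_assoc]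
  obtain ⟨c, hc, h⟩ := hU.exists_mul_toOp P
  obtain ⟨d, hd, h'⟩ := hU.exists_mul_toOp Q
  have hc0 : c ≠ 0 := by rintro rfl; simp at hc
  have hd0 : d ≠ 0 := by rintro rfl; simp at hd
  have e1 := key P Q h h'
  have e2 := key Q P h' h
  refine comm_eq_of_toOp_mul_comm ?_
  rw [toOp_mul_comm P Q, mul_smul_comm, e2, smul_comm, mul_comm d c] at e1
  have e3 := smul_right_injective _ (mul_ne_zero hc0 hd0) e1
  have e4 := congrArg
    (· * ((U⁻¹ : Matrix.unitaryGroup (ι → Fin 2) ℂ) : QubitOp ι)) e3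
  simp only [smul_mul_assoc] at e4
  rw [mul_assoc _ (U : QubitOp ι), unitaryGroup_mul_inv, mul_one, mul_assoc _ (U : QubitOp ι),
    unitaryGroup_mul_inv, mul_one] at e4
  exact e4.symm

theorem pauliConj_mul {U : Matrix.unitaryGroup (ι → Fin 2) ℂ} (hU : IsClifford U)
    (P Q : PauliString ι) : pauliConj U (P * Q) = pauliConj U P * pauliConj U Q := by
  obtain ⟨c, hc, h⟩ := hU.exists_mul_toOp P
  obtain ⟨d, hd, h'⟩ := hU.exists_mul_toOp Q
  obtain ⟨a, ha, e⟩ := exists_toOp_mul P Q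
  obtain ⟨b, hb, e'⟩ := exists_toOp_mul (pauliConj U P) (pauliConj U Q)
  have ha0 : a ≠ 0 := by rintro rfl; simp at ha
  refine pauliConj_eq_of_mul_eq (c := a⁻¹ * (c * d * b)) ?_ ?_
  · rw [mul_pow, mul_pow, mul_pow, inv_pow, ha, hb, hc, hd]; simp
  · have e1 : (P * Q).toOp = a⁻¹ • (P.toOp * Q.toOp) := by
      rw [e, smul_smul, inv_mul_cancel₀ ha0, one_smul]
    rw [e1, mul_smul_comm, ← mul_assoc, h, smul_mul_assoc, mul_assoc, h', mul_smul_comm,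
      ← mul_assoc, e', smul_mul_assoc]
    simp only [smul_smul, mul_assoc]

theorem pauliConj_injective {U : Matrix.unitaryGroup (ι → Fin 2) ℂ} (hU : IsClifford U) :
    Function.Injective (pauliConj U : PauliString ι → PauliString ι) := by
  intro P Q h
  refine eq_of_comm_eq fun R => ?_
  rw [← comm_pauliConj hU P R, h, comm_pauliConj hU]

/-- Conjugation by `U` is injective on the finite set of Pauli strings, hence surjective, so it can
be reversed. -/
theorem IsClifford.inv {U : Matrix.unitaryGroup (ι → Fin 2) ℂ} (hU : IsClifford U) :
    IsClifford U⁻¹ := by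
  refine isClifford_of_exists fun P => ?_
  obtain ⟨Q, rfl⟩ := (Finite.injective_iff_surjective.mp (pauliConj_injective hU)) P
  obtain ⟨c, hc, h⟩ := hU.exists_mul_toOp Q
  have hc0 : c ≠ 0 := by rintro rfl; simp at hc
  refine ⟨Q, c⁻¹, by rw [inv_pow, hc, inv_one], ?_⟩
  have h' : (pauliConj U Q).toOp = c⁻¹ • ((U : QubitOp ι) * Q.toOp *
      ((U⁻¹ : Matrix.unitaryGroup (ι → Fin 2) ℂ) : QubitOp ι)) := by
    rw [h, smul_mul_assoc, smul_smul, inv_mul_cancel₀ hc0, one_smul, mul_assoc,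
      unitaryGroup_mul_inv, mul_one]
  rw [h', mul_smul_comm, mul_assoc, ← mul_assoc, unitaryGroup_inv_mul, one_mul]

theorem pauliConj_inv_pauliConj {U : Matrix.unitaryGroup (ι → Fin 2) ℂ} (hU : IsClifford U)
    (P : PauliString ι) : pauliConj U (pauliConj U⁻¹ P) = P := by
  rw [← pauliConj_mul_unitary hU hU.inv, mul_inv_cancel, pauliConj_one]

theorem comm_pauliConj_inv {U : Matrix.unitaryGroup (ι → Fin 2) ℂ} (hU : IsClifford U)
    (P Q : PauliString ι) : comm P (pauliConj U⁻¹ Q) = comm (pauliConj U P) Q := by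
  rw [← comm_pauliConj hU, pauliConj_inv_pauliConj hU]

/-- An operator acting trivially on `q` commutes with the Pauli operators supported on `q`. -/
theorem ActsTriviallyAt.commute_mulSingle {A : QubitOp ι} {q : ι} (hA : ActsTriviallyAt A q)
    (p : Pauli) : Commute A (PauliString.toOp (Pi.mulSingle q p)) := by
  obtain ⟨B, hB⟩ := hA
  have hS (x y : ι → Fin 2) : PauliString.toOp (Pi.mulSingle q p) x y =
      if (∀ q' : {q' // q' ≠ q}, x q' = y q') then p.toMatrix (x q) (y q) else 0 := by
    rw [PauliString.toOp, Matrix.of_apply, ← Finset.mul_prod_erase _ _ (Finset.mem_univ q),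
      Pi.mulSingle_eq_same]
    have : ∏ q' ∈ Finset.univ.erase q,
        ((Pi.mulSingle q p : PauliString ι) q').toMatrix (x q') (y q') =
        ∏ q' ∈ Finset.univ.erase q, if x q' = y q' then (1 : ℂ) else 0 := by
      refine Finset.prod_congr rfl fun q' hq' => ?_
      rw [Pi.mulSingle_eq_of_ne (Finset.ne_of_mem_erase hq'), Pauli.toMatrix_one,
        Matrix.one_apply]
    rw [this, Finset.prod_ite_zero]
    simp
  have hupd (x y : ι → Fin 2) (h : ∀ q' : {q' // q' ≠ q}, x q' = y q') :
      x = Function.update y q (x q) := by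
    funext q'
    by_cases e : q' = q
    · subst e; simp
    · rw [Function.update_of_ne e, h ⟨q', e⟩]
  refine Matrix.ext fun x y => ?_
  -- Trivial action of `A` fixes the intermediate index at `q`, and the single-qubit Pauli fixes it
  -- away from `q`: one term of each sum survives.
  rw [Matrix.mul_apply, Matrix.mul_apply, Finset.sum_eq_single (Function.update y q (x q)),
    Finset.sum_eq_single (Function.update x q (y q))]
  · rw [hB, hB, hS, hS]
    have e1 : (fun q' : {q' // q' ≠ q} => Function.update y q (x q) q') =
        fun q' : {q' // q' ≠ q} => y q' :=
      funext fun q' => Function.update_of_ne q'.2 _ _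
    have e2 : (fun q' : {q' // q' ≠ q} => Function.update x q (y q) q') =
        fun q' : {q' // q' ≠ q} => x q' :=
      funext fun q' => Function.update_of_ne q'.2 _ _
    rw [e1, e2, if_pos (by simp), if_pos (fun q' => congrFun e1 q'),
      if_pos (fun q' => (congrFun e2 q').symm), if_pos (by simp)]
    simp [mul_comm]
  · intro z _ hz
    rw [hB, hS]
    split_ifs with h1 h2
    · exact absurd (by rw [← h2]; exact hupd _ _ fun q' => (h1 q').symm) hz
    all_goals simp
  · simp
  · intro z _ hz
    rw [hB, hS]
    split_ifs with h2 h1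
    · exact absurd (by rw [h2]; exact hupd _ _ h1) hz
    all_goals simp
  · simp

/-- Conjugation is multiplicative, so it suffices to treat the single-qubit factors of `P`, each of
which commutes with `U`. -/
theorem pauliConj_eq_self_of_disjoint {U : Matrix.unitaryGroup (ι → Fin 2) ℂ}
    (hU : IsClifford U) {P : PauliString ι}
    (h : ∀ q, P q ≠ 1 → ActsTriviallyAt (U : QubitOp ι) q) : pauliConj U P = P := by
  have key (s : Finset ι) : pauliConj U (∏ q ∈ s, Pi.mulSingle q (P q)) =
      ∏ q ∈ s, Pi.mulSingle q (P q) := by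
    induction s using Finset.induction_on with
    | empty =>
      rw [Finset.prod_empty]
      exact pauliConj_eq_of_mul_eq (one_pow 4) (by simp [toOp_one])
    | insert q s hq ih =>
      rw [Finset.prod_insert hq, pauliConj_mul hU, ih]
      congr 1
      refine pauliConj_eq_of_mul_eq (one_pow 4) ?_
      rw [one_smul]
      by_cases hP : P q = 1
      · rw [hP, Pi.mulSingle_one, toOp_one, one_mul, mul_one]
      · exact ((h q hP).commute_mulSingle (P q)).eq
  have := key Finset.univ
  rwa [Finset.univ_prod_mulSingle] at this

end Conjugation

end
noncomputable section

open PauliString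

/-- A filter splits as a concatenation when the two parts occur one after the other. -/
theorem List.filter_eq_append_filter {α : Type*} {p q r : α → Bool} {L : List α}
    (hL : L.Pairwise fun i j => q i = true → p j = false) (hr : ∀ i, r i = (p i || q i))
    (hd : ∀ i, q i = true → p i = false) : L.filter r = L.filter p ++ L.filter q := by
  induction L with
  | nil => rfl
  | cons i L ih =>
    obtain ⟨hi, hL⟩ := List.pairwise_cons.mp hL
    rw [List.filter_cons, List.filter_cons, List.filter_cons, ih hL, hr]
    cases hq : q i with
    | false => cases p i <;> simp
    | true =>
      have hnil : L.filter p = [] := List.filter_eq_nil_iff.mpr fun j hj => by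
        simp [hi j hj hq]
      simp [hd i hq, hnil]

/-! ### Measurement projectors and Pauli operators -/

namespace CliffordOp

variable {n : ℕ}

theorem isClifford_unitaryPart (A : CliffordOp n) : IsClifford A.unitaryPart := by
  cases A with
  | gate U hU => exact hU
  | measure s P => exact isClifford_one

theorem kraus_of_not_isMeasure {A : CliffordOp n} (h : A.isMeasure ≠ true) (b : ZMod 2) :
    A.kraus b = A.unitaryPart := by
  cases A with
  | gate U hU => rfl
  | measure s P => exact absurd rfl h

theorem mem_support_of_measured_ne_one {A : CliffordOp n} {q : Fin n} (h : A.measured q ≠ 1) :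
    q ∈ A.support := by
  cases A with
  | gate U hU => exact absurd rfl h
  | measure s P => exact h

theorem measure_kraus_mul_toOp (s : ℤˣ) (S Q : PauliString (Fin n)) (b : ZMod 2) :
    (measure s S).kraus b * Q.toOp = Q.toOp * (measure s S).kraus (b + comm Q S) := by
  have h : ((-1 : ℂ) ^ b.val) • (S.toOp * Q.toOp) =
      ((-1 : ℂ) ^ (b + comm Q S).val) • (Q.toOp * S.toOp) := by
    rw [toOp_mul_comm S Q, smul_smul, comm_symm S]
    exact congrArg (· • (Q.toOp * S.toOp)) (zmodTwoSign_add _ _).symm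
  simp only [kraus, smul_mul_assoc, mul_smul_comm, add_mul, mul_add, one_mul, mul_one]
  rw [mul_comm, mul_smul, h, smul_smul, mul_comm ((s : ℤ) : ℂ)]

/-- The projector maps onto an eigenspace of the measured operator. -/
theorem toOp_mul_measure_kraus (s : ℤˣ) (S : PauliString (Fin n)) (b : ZMod 2) :
    S.toOp * (measure s S).kraus b =
      ((-1 : ℂ) ^ b.val * ((s : ℤ) : ℂ)) • (measure s S).kraus b := by
  have h : ((-1 : ℂ) ^ b.val * ((s : ℤ) : ℂ)) * ((-1 : ℂ) ^ b.val * ((s : ℤ) : ℂ)) = 1 := by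
    rcases ZMod.eq_zero_or_eq_one_of_two b with rfl | rfl <;>
      rcases Int.units_eq_one_or s with rfl | rfl <;> simp [ZMod.val_one]
  rw [kraus, mul_smul_comm, mul_add, mul_one, mul_smul_comm, toOp_mul_self, smul_comm _ (1 / 2 : ℂ)]
  congr 1
  rw [smul_add, smul_smul, h, one_smul, add_comm]

end CliffordOp

namespace CliffordCircuit

variable {n : ℕ} (C : CliffordCircuit n)

/-! ### Kraus operators and outcomes -/

/-- The operator applied by the operations listed in `L`, in this order, for the outcomes `o`. -/
def krausList (o : C.Meas → ZMod 2) : List (Fin C.size) → QubitOp (Fin n)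
  | [] => 1
  | i :: L => krausList o L * C.krausAt o i

theorem krausList_append (o : C.Meas → ZMod 2) (L₁ L₂ : List (Fin C.size)) :
    C.krausList o (L₁ ++ L₂) = C.krausList o L₂ * C.krausList o L₁ := by
  induction L₁ with
  | nil => simp [krausList]
  | cons i L ih => rw [List.cons_append, krausList, krausList, ih, mul_assoc]

theorem foldl_krausAt (o : C.Meas → ZMod 2) (L : List (Fin C.size)) (ρ : QubitOp (Fin n)) :
    L.foldl (fun σ i => C.krausAt o i * σ * (C.krausAt o i)ᴴ) ρ =
      C.krausList o L * ρ * (C.krausList o L)ᴴ := by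
  induction L generalizing ρ with
  | nil => simp [krausList]
  | cons i L ih =>
    rw [List.foldl_cons, ih, krausList, Matrix.conjTranspose_mul]
    simp only [mul_assoc]

theorem krausList_congr {o o' : C.Meas → ZMod 2} {L : List (Fin C.size)}
    (h : ∀ j : C.Meas, (j : Fin C.size) ∈ L → o j = o' j) :
    C.krausList o L = C.krausList o' L := by
  induction L with
  | nil => rfl
  | cons i L ih =>
    rw [krausList, krausList, ih fun j hj => h j (List.mem_cons_of_mem _ hj)]
    congr 1
    unfold krausAt
    congr 1
    split_ifs with hi
    · exact h ⟨i, hi⟩ List.mem_cons_self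
    · rfl

theorem mem_outcomeCode_iff (o : C.Meas → ZMod 2) :
    o ∈ C.outcomeCode ↔ C.krausList o (List.finRange C.size) ≠ 0 := by
  set K := C.krausList o (List.finRange C.size) with hK
  have hout (ρ : QubitOp (Fin n)) : C.outcomeProb ρ o = (K * ρ * Kᴴ).trace.re := by
    rw [outcomeProb, outputState, foldl_krausAt]
  constructor
  · rintro ⟨ρ, -, hρ⟩ h0
    rw [hout, h0] at hρ
    simp at hρ
  · intro h0
    set N : ℂ := (Fintype.card (Fin n → Fin 2) : ℂ) with hN
    have hN0 : 0 < N := by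
      rw [hN]; exact_mod_cast Fintype.card_pos
    -- On the maximally mixed state the probability is `tr (K Kᴴ) / N`, positive as soon as `K ≠ 0`.
    refine ⟨N⁻¹ • 1, ⟨Matrix.PosSemidef.one.smul (inv_nonneg.mpr hN0.le), ?_⟩, ?_⟩
    · rw [Matrix.trace_smul, Matrix.trace_one, smul_eq_mul, inv_mul_cancel₀ hN0.ne']
    · have hpos : 0 < (K * Kᴴ).trace :=
        lt_of_le_of_ne (Matrix.posSemidef_self_mul_conjTranspose K).trace_nonneg
          (Ne.symm (mt Matrix.trace_mul_conjTranspose_self_eq_zero_iff.mp h0))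
      rw [hout, mul_smul_comm, mul_one, smul_mul_assoc, Matrix.trace_smul, smul_eq_mul]
      exact (Complex.pos_iff.mp (mul_pos (inv_pos.mpr hN0) hpos)).1

/-! ### The back-cumulant of the measured operators, operation by operation -/

/-- The measured operator of the `i`-th operation raised to the power given by `u`, trivial when
the operation is a gate. -/
def measuredPow (u : C.Meas → ZMod 2) (i : Fin C.size) : PauliString (Fin n) :=
  if h : (C.op i).isMeasure = true then (C.op i).measured ^ (u ⟨i, h⟩).val else 1

/-- Propagation of `B` backward through the operations listed in `L`, where each measured operator
selected by `u` is multiplied in when it is crossed. -/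
def backProp (u : C.Meas → ZMod 2) (B : PauliString (Fin n)) :
    List (Fin C.size) → PauliString (Fin n)
  | [] => B
  | i :: L => C.measuredPow u i * pauliConj (C.op i).unitaryPart⁻¹ (backProp u B L)

theorem backProp_append (u : C.Meas → ZMod 2) (B : PauliString (Fin n))
    (L₁ L₂ : List (Fin C.size)) :
    C.backProp u B (L₁ ++ L₂) = C.backProp u (C.backProp u B L₂) L₁ := by
  induction L₁ with
  | nil => rfl
  | cons i L ih => rw [List.cons_append, backProp, backProp, ih]

/-! ### Outcome flips and commutation of back-propagated operators -/

/-- A Pauli operator inserted before the operations of `L` acts as a Pauli operator after them and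
a flip `f` of the outcomes; the pairing of `f` with `u` is the commutator of the inserted operator
with the back-propagated measured operators. -/
theorem exists_flip (L : List (Fin C.size)) (hL : L.Nodup) (Q : PauliString (Fin n)) :
    ∃ f : C.Meas → ZMod 2, (∀ j : C.Meas, (j : Fin C.size) ∉ L → f j = 0) ∧
      (∀ u, u ⬝ᵥ f = comm Q (C.backProp u 1 L)) ∧
      ∃ (c : ℂ) (R : PauliString (Fin n)), ∀ o,
        C.krausList o L * Q.toOp = c • (R.toOp * C.krausList (o + f) L) := by
  induction L generalizing Q with
  | nil =>
    exact ⟨0, fun _ _ => rfl, fun u => by simp [backProp, comm_one_right], 1, Q, fun o => by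
      simp [krausList]⟩
  | cons i L ih =>
    obtain ⟨hi, hL⟩ := List.nodup_cons.mp hL
    obtain ⟨f, hf, hu, c, R, hK⟩ := ih hL (pauliConj (C.op i).unitaryPart Q)
    cases hop : C.op i with
    | gate U hU =>
      have hm : (C.op i).isMeasure ≠ true := by simp [hop, CliffordOp.isMeasure]
      have hV : (C.op i).unitaryPart = U := by rw [hop]; rfl
      have hk (o) : C.krausAt o i = U := by
        rw [krausAt, CliffordOp.kraus_of_not_isMeasure hm, hV]
      obtain ⟨d, -, hd⟩ := hU.exists_mul_toOp Q
      refine ⟨f, fun j hj => hf j fun h => hj (List.mem_cons_of_mem _ h), fun u => ?_,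
        d * c, R, fun o => ?_⟩
      · rw [hu, backProp, measuredPow, dif_neg hm, one_mul,
          comm_pauliConj_inv (C.op i).isClifford_unitaryPart]
      · rw [hV] at hK
        rw [krausList, krausList, hk, hk, mul_assoc, hd, mul_smul_comm, ← mul_assoc, hK,
          smul_mul_assoc, smul_smul, mul_assoc]
    | measure s S =>
      have hm : (C.op i).isMeasure = true := by simp [hop, CliffordOp.isMeasure]
      have hV : (C.op i).unitaryPart = 1 := by rw [hop]; rfl
      have hS : (C.op i).measured = S := by rw [hop]; rfl
      have hk (o) : C.krausAt o i = (CliffordOp.measure s S).kraus (o ⟨i, hm⟩) := by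
        rw [krausAt, dif_pos hm, hop]
      rw [hV, pauliConj_one] at hu hK
      classical
      -- The outcome at `i` flips exactly when `Q` anticommutes with `S`; `Q` then continues
      -- unchanged into `L`.
      refine ⟨f + Pi.single ⟨i, hm⟩ (comm Q S), fun j hj => ?_, fun u => ?_, c, R, fun o => ?_⟩
      · have hj' : j ≠ ⟨i, hm⟩ := by rintro rfl; exact hj List.mem_cons_self
        rw [Pi.add_apply, Pi.single_eq_of_ne hj', add_zero,
          hf j fun h => hj (List.mem_cons_of_mem _ h)]
      · rw [dotProduct_add, hu, dotProduct_single, backProp, measuredPow, dif_pos hm, hV, hS,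
          inv_one, pauliConj_one, comm_mul_right, comm_pow_right, add_comm]
      · have hfi : f ⟨i, hm⟩ = 0 := hf _ hi
        have e : C.krausList (o + (f + Pi.single ⟨i, hm⟩ (comm Q S))) L =
            C.krausList (o + f) L := by
          refine C.krausList_congr fun j hj => ?_
          have hj' : j ≠ ⟨i, hm⟩ := by rintro rfl; exact hi hj
          rw [Pi.add_apply, Pi.add_apply, Pi.single_eq_of_ne hj', add_zero, Pi.add_apply]
        rw [krausList, krausList, e, hk, hk, mul_assoc, CliffordOp.measure_kraus_mul_toOp,
          ← mul_assoc, hK, Pi.add_apply, Pi.add_apply, hfi, zero_add, Pi.single_eq_same,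
          smul_mul_assoc, mul_assoc]

/-- For `u` in the dual of a linear outcome code, the back-propagation of the measured operators
selected by `u` commutes with the operator measured just before. -/
theorem comm_measured_backProp {O : Submodule (ZMod 2) (C.Meas → ZMod 2)}
    (hO : (O : Set (C.Meas → ZMod 2)) = C.outcomeCode) {u : C.Meas → ZMod 2}
    (hu : u ∈ dualCode O) {L₁ L₂ : List (Fin C.size)} {i : Fin C.size}
    (h : List.finRange C.size = L₁ ++ i :: L₂) (hi : (C.op i).isMeasure = true) :
    comm (C.op i).measured (C.backProp u 1 L₂) = 0 := by
  have hnd : (L₁ ++ i :: L₂).Nodup := h ▸ List.nodup_finRange _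
  obtain ⟨-, hnd2, hdis⟩ := List.nodup_append.mp hnd
  obtain ⟨hi2, hnd2⟩ := List.nodup_cons.mp hnd2
  obtain ⟨f, hf, hfu, c, R, hK⟩ := C.exists_flip L₂ hnd2 (C.op i).measured
  have hmem : f ∈ O := by
    rw [← SetLike.mem_coe, hO, mem_outcomeCode_iff]
    -- Linearity enters here: the zero string is a codeword.
    have h0 : C.krausList 0 (List.finRange C.size) ≠ 0 := by
      rw [← mem_outcomeCode_iff, ← hO]
      exact O.zero_mem
    intro hz
    apply h0
    rw [h, krausList_append, krausList] at hz ⊢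
    have e1 : C.krausList f L₁ = C.krausList 0 L₁ :=
      C.krausList_congr fun j hj => hf j fun hj2 =>
        hdis j hj j (List.mem_cons_of_mem _ hj2) rfl
    have e2 : C.krausAt f i = C.krausAt 0 i := by
      rw [krausAt, krausAt, dif_pos hi, dif_pos hi, hf _ hi2]; rfl
    have e3 := hK 0
    rw [zero_add] at e3
    rw [e1, e2] at hz
    cases hop : C.op i with
    | gate U hU => simp [hop, CliffordOp.isMeasure] at hi
    | measure s S =>
      have hk : C.krausAt 0 i = (CliffordOp.measure s S).kraus 0 := by
        rw [krausAt, dif_pos hi, hop]; rfl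
      have hs : ((s : ℤ) : ℂ) ≠ 0 := by simp
      have hS : (C.op i).measured = S := by rw [hop]; rfl
      have e4 := CliffordOp.toOp_mul_measure_kraus s S 0
      rw [ZMod.val_zero, pow_zero, one_mul, ← hk] at e4
      rw [hS] at e3
      -- The sign comes from writing the projector at `i` as absorbing `S`; pushing that `S` through
      -- `L₂` turns outcomes `0` into `f`, whose Kraus product was assumed zero.
      have e5 : ((s : ℤ) : ℂ) • (C.krausList 0 L₂ * C.krausAt 0 i * C.krausList 0 L₁) = 0 := by
        rw [← smul_mul_assoc, ← mul_smul_comm, ← e4, ← mul_assoc, e3, smul_mul_assoc,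
          smul_mul_assoc, mul_assoc R.toOp, mul_assoc R.toOp, hz, mul_zero, smul_zero]
      exact (smul_eq_zero.mp e5).resolve_left hs
  rw [← hfu]
  exact hu f hmem

/-- Induction runs from the end of the circuit; `L₁` is generalized because each step needs `L₂` to
be a genuine tail of the full sequence. -/
theorem comm_backProp {O : Submodule (ZMod 2) (C.Meas → ZMod 2)}
    (hO : (O : Set (C.Meas → ZMod 2)) = C.outcomeCode) {u v : C.Meas → ZMod 2}
    (hu : u ∈ dualCode O) (hv : v ∈ dualCode O) (L₁ L₂ : List (Fin C.size))
    (h : List.finRange C.size = L₁ ++ L₂) :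
    comm (C.backProp u 1 L₂) (C.backProp v 1 L₂) = 0 := by
  induction L₂ generalizing L₁ with
  | nil => exact comm_self 1
  | cons i L ih =>
    have ih := ih (L₁ ++ [i]) (by rw [h, List.append_assoc]; rfl)
    by_cases hi : (C.op i).isMeasure = true
    · have hV : (C.op i).unitaryPart = 1 := by
        cases hop : C.op i with
        | gate U hU => simp [hop, CliffordOp.isMeasure] at hi
        | measure s S => rfl
      have h1 := C.comm_measured_backProp hO hu h hi
      have h2 := C.comm_measured_backProp hO hv h hi
      simp only [backProp, measuredPow, dif_pos hi, hV, inv_one, pauliConj_one, comm_mul_left,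
        comm_mul_right, comm_pow_left, comm_pow_right, comm_self, ih, h2, mul_zero, zero_add]
      rw [comm_symm, h1, mul_zero, zero_add]
    · simp only [backProp, measuredPow, dif_neg hi, one_mul]
      rw [comm_pauliConj (C.op i).isClifford_unitaryPart.inv, ih]

/-! ### Comparison with the back-cumulant, level by level -/

theorem mem_support_of_measuredPow_ne_one {u : C.Meas → ZMod 2} {i : Fin C.size} {q : Fin n}
    (h : C.measuredPow u i q ≠ 1) : q ∈ (C.op i).support := by
  refine CliffordOp.mem_support_of_measured_ne_one fun hq => h ?_
  unfold measuredPow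
  split_ifs with hi
  · rw [Pi.pow_apply, hq, one_pow]
  · rfl

theorem pauliConj_measuredPow (u : C.Meas → ZMod 2) {i j : Fin C.size} (hij : i ≠ j)
    (hl : C.level i = C.level j) :
    pauliConj (C.op i).unitaryPart⁻¹ (C.measuredPow u j) = C.measuredPow u j := by
  have hfix : pauliConj (C.op i).unitaryPart (C.measuredPow u j) = C.measuredPow u j := by
    have hdis := C.disjoint_support i j hij hl
    cases hop : C.op i with
    | gate U hU =>
      refine pauliConj_eq_self_of_disjoint hU fun q hq => ?_
      by_contra hn
      refine Set.disjoint_left.mp hdis ?_ (C.mem_support_of_measuredPow_ne_one hq)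
      rw [hop]
      exact hn
    | measure s S => exact pauliConj_one _
  have hU := (C.op i).isClifford_unitaryPart
  apply pauliConj_injective hU
  rw [pauliConj_inv_pauliConj hU, hfix]

/-- The product, in chronological order, of the unitaries of the operations in `L`. -/
def listUnitary (L : List (Fin C.size)) : Matrix.unitaryGroup (Fin n → Fin 2) ℂ :=
  (L.map fun i => (C.op i).unitaryPart).reverse.prod

theorem listUnitary_cons (i : Fin C.size) (L : List (Fin C.size)) :
    C.listUnitary (i :: L) = C.listUnitary L * (C.op i).unitaryPart := by
  simp [listUnitary]

theorem isClifford_listUnitary (L : List (Fin C.size)) : IsClifford (C.listUnitary L) := by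
  induction L with
  | nil => exact isClifford_one
  | cons i L ih =>
    rw [listUnitary_cons]
    exact ih.mul (C.op i).isClifford_unitaryPart

/-- Within a level, gates fix the operators measured by other operations, so all measured operators
can be collected in front of the conjugation. -/
theorem backProp_eq_of_level_eq (u : C.Meas → ZMod 2) (B : PauliString (Fin n)) (l : ℕ)
    (L : List (Fin C.size)) (hL : L.Nodup) (hl : ∀ i ∈ L, C.level i = l) :
    C.backProp u B L =
      (L.map (C.measuredPow u)).prod * pauliConj (C.listUnitary L)⁻¹ B := by
  induction L with
  | nil =>
    have h1 : C.listUnitary [] = 1 := rfl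
    rw [List.map_nil, List.prod_nil, one_mul, h1, inv_one, pauliConj_one]
    rfl
  | cons i L ih =>
    obtain ⟨hi, hL⟩ := List.nodup_cons.mp hL
    have hU := (C.op i).isClifford_unitaryPart.inv
    have key (L' : List (Fin C.size)) (hsub : ∀ j ∈ L', j ∈ L) :
        pauliConj (C.op i).unitaryPart⁻¹ (L'.map (C.measuredPow u)).prod =
          (L'.map (C.measuredPow u)).prod := by
      induction L' with
      | nil =>
        refine pauliConj_eq_of_mul_eq (one_pow 4) ?_
        simp [toOp_one]
      | cons j L' ih' =>
        rw [List.map_cons, List.prod_cons, pauliConj_mul hU,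
          ih' fun k hk => hsub k (List.mem_cons_of_mem _ hk)]
        have hj := hsub j List.mem_cons_self
        have hij : i ≠ j := by rintro rfl; exact hi hj
        rw [C.pauliConj_measuredPow u hij
          ((hl i List.mem_cons_self).trans (hl j (List.mem_cons_of_mem _ hj)).symm)]
    rw [backProp, ih hL fun j hj => hl j (List.mem_cons_of_mem _ hj), pauliConj_mul hU,
      key L fun j hj => hj, listUnitary_cons, mul_inv_rev,
      pauliConj_mul_unitary hU (C.isClifford_listUnitary L).inv, List.map_cons, List.prod_cons,
      mul_assoc]

theorem slice_measurementFault (u : C.Meas → ZMod 2) (l : Fin (C.depth + 1)) :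
    FaultOp.slice (C.measurementFault u) l =
      (((List.finRange C.size).filter fun i => C.level i = l + 1).map (C.measuredPow u)).prod := by
  have hs : FaultOp.slice (C.measurementFault u) l =
      ∏ j : C.Meas, if C.level j = l + 1 then C.measuredPow u j else 1 := by
    funext q
    rw [FaultOp.slice, measurementFault, Finset.prod_apply, Finset.prod_apply]
    refine Finset.prod_congr rfl fun j _ => ?_
    have h1 := C.one_le_level j
    -- Levels start at `1`, so the truncated subtraction is exact.
    have hiff : l = ⟨C.level j - 1, C.level_sub_one_lt j⟩ ↔ C.level j = l + 1 := by
      rw [Fin.ext_iff]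
      dsimp only
      omega
    rw [eta, measuredPow, dif_pos j.2]
    simp only [hiff]
    split_ifs <;> rfl
  rw [hs]
  have hp : ∏ j : C.Meas, (if C.level j = l + 1 then C.measuredPow u j else 1) =
      ∏ i : Fin C.size, if C.level i = l + 1 then C.measuredPow u i else 1 := by
    -- Gates contribute trivial factors, so the product extends to all operations.
    rw [← Fintype.prod_subtype_mul_prod_subtype (fun i => (C.op i).isMeasure = true)]
    refine (mul_eq_left.mpr (Finset.prod_eq_one fun i _ => ?_)).symm
    rw [measuredPow, dif_neg i.2, ite_self]
  rw [hp, Fin.prod_univ_def, List.prod_map_ite]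
  refine mul_eq_left.mpr (List.prod_eq_one fun x hx => ?_)
  obtain ⟨_, -, rfl⟩ := List.mem_map.mp hx
  rfl

theorem pairwise_finRange_level :
    (List.finRange C.size).Pairwise fun i j => C.level i ≤ C.level j :=
  (List.pairwise_le_finRange _).imp fun h => C.level_mono _ _ h

/-- Both sides obey the same backward recursion: passing from `l + 1` to `l` adjoins precisely the
operations of level `l + 1`, which come before the later ones because levels are monotone. -/
theorem slice_checkOperator (u : C.Meas → ZMod 2) (l : Fin (C.depth + 1)) :
    FaultOp.slice (C.checkOperator u) l =
      C.backProp u 1 ((List.finRange C.size).filter fun i => (l : ℕ) < C.level i) := by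
  induction l using Fin.reverseInduction with
  | last =>
    have h1 : FaultOp.slice (C.checkOperator u) (Fin.last _) =
        FaultOp.slice (C.measurementFault u) (Fin.last _) := by
      funext q
      simp [FaultOp.slice, checkOperator, backCumulant]
    have hle (i : Fin C.size) : C.level i ≤ C.depth :=
      Finset.le_sup (f := C.level) (Finset.mem_univ i)
    -- No level exceeds the depth, so both lists are empty.
    rw [h1, slice_measurementFault, List.filter_eq_nil_iff.mpr, List.filter_eq_nil_iff.mpr]
    · rfl
    · intro i _
      simpa using hle i
    · intro i _
      have := hle i
      simp
      omega
  | cast l ih =>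
    have h1 : FaultOp.slice (C.checkOperator u) l.castSucc =
        FaultOp.slice (C.measurementFault u) l.castSucc *
          pauliConj (C.levelUnitary (l + 1))⁻¹ (FaultOp.slice (C.checkOperator u) l.succ) := by
      funext q
      simp only [FaultOp.slice, checkOperator, backCumulant, Fin.reverseInduction_castSucc]
      rfl
    have hsplit : ((List.finRange C.size).filter fun i => (l : ℕ) < C.level i) =
        ((List.finRange C.size).filter fun i => C.level i = l + 1) ++
          (List.finRange C.size).filter fun i => (l : ℕ) + 1 < C.level i := by
      refine List.filter_eq_append_filter (C.pairwise_finRange_level.imp fun h => ?_)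
        (fun i => ?_) fun i => ?_
      · simp only [decide_eq_true_eq, decide_eq_false_iff_not]; omega
      · rw [← Bool.decide_or, decide_eq_decide]; omega
      · simp only [decide_eq_true_eq, decide_eq_false_iff_not]; omega
    rw [h1, ih, slice_measurementFault, Fin.val_castSucc, Fin.val_succ, hsplit, backProp_append,
      C.backProp_eq_of_level_eq u (C.backProp u 1 _) (l + 1)
        ((List.finRange C.size).filter fun i => C.level i = l + 1) ((List.nodup_finRange _).filter _)
        (fun i hi => by simpa using hi)]
    rfl

theorem exists_finRange_eq_append_filter (l : ℕ) :
    ∃ L, List.finRange C.size =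
      L ++ (List.finRange C.size).filter fun i => l < C.level i := by
  refine ⟨(List.finRange C.size).filter fun i => C.level i ≤ l, ?_⟩
  rw [← List.filter_eq_append_filter (r := fun _ => true), List.filter_true]
  · refine C.pairwise_finRange_level.imp fun h => ?_
    simp only [decide_eq_true_eq, decide_eq_false_iff_not]; omega
  · intro i
    simp only [← Bool.decide_or, eq_comm (a := true), decide_eq_true_eq]; omega
  · intro i
    simp only [decide_eq_true_eq, decide_eq_false_iff_not]; omega

end CliffordCircuit

end

theorem mainTheorem5 {n : ℕ} (C : CliffordCircuit n)
    (O : Submodule (ZMod 2) (C.Meas → ZMod 2))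
    (hO : (O : Set (C.Meas → ZMod 2)) = C.outcomeCode)
    (u v : C.Meas → ZMod 2) (hu : u ∈ dualCode O) (hv : v ∈ dualCode O) :
    pauliCommutator (C.checkOperator u) (C.checkOperator v) = 0 := by
  rw [PauliString.pauliCommutator_eq_comm, PauliString.comm, Fintype.sum_prod_type]
  refine Finset.sum_eq_zero fun l _ => ?_
  obtain ⟨L, hL⟩ := C.exists_finRange_eq_append_filter l
  have h := C.comm_backProp hO hu hv L _ hL
  rwa [← C.slice_checkOperator u l, ← C.slice_checkOperator v l] at h
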